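/- For natural numbers $m\ge 4$ put $\zeta_m=e^{2\pi i/m}$, let $$D_m=\{(k_1,k_2,k_3,k_4)\in\mathbb{N}^4 : 1\le k_3<k_1\le k_2<k_4\le m-1,\ k_1+k_2=k_3+k_4\},$$ and for $d=(k_1,k_2,k_3,k_4)\in D_m$ let $$f_m(d)=\frac{(1-\zeta_m^{k_1})(1-\zeta_m^{k_2})}{(1-\zeta_m^{k_3})(1-\zeta_m^{k_4})}.$$ Let $\mathcal{C}=\bigcup_{m\ge 4} f_m(D_m)\subset\mathbb{C}$. Theorem. Let $L\subset\mathbb{R}$ be a real algebraic number field (a finite extension of $\mathbb{Q}$). Then the set $\mathcal{C}(L)=\mathcal{C}\cap L$ is finite. Moreover, there are a natural number $m_L\ge 4$ and a finite list $S_L\subset D_{m_L}$ of quadruples $d'$ with $f_{m_L}(d')\in L$ such that, for all $m\ge 4$ and $d\in D_m$ with $f_m(d)\in L$, at least one of the following holds: * (xii) $f_m(d)=2$, $m=2s$ and $d=(2k,s,k,k+s)$ for some natural numbers $s\ge 2$ and $1\le k\le s/2$; * (xiii) $f_m(d)=2$, $m=2s$ and $d=(s,2k,k,k+s)$ for some natural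 numbers $s\ge 2$ and $s/2\le k<s$; * $(m,d)$ equals $(m_L,d')$ with some $d'\in S_L$, up to multiplication by a common factor, that is, $m=c\,m_L$ and $d=c\,d'$ for some positive rational number $c$. -/

import Mathlib

/-- The primitive `m`-th root of unity `ζ_m = exp (2 π i / m)`. -/
noncomputable def zetaRoot (m : ℕ) : ℂ :=
  Complex.exp (2 * (Real.pi : ℂ) * Complex.I / (m : ℂ))

/-- The set `D_m` of quadruples `(k₁, k₂, k₃, k₄)` of positive integers with
`k₃ < k₁ ≤ k₂ < k₄ ≤ m - 1` and `k₁ + k₂ = k₃ + k₄`; here `kᵢ` is `d (i - 1)`. -/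
def quadruples (m : ℕ) : Set (Fin 4 → ℕ) :=
  {d | 0 < d 2 ∧ d 2 < d 0 ∧ d 0 ≤ d 1 ∧ d 1 < d 3 ∧ d 3 < m ∧ d 0 + d 1 = d 2 + d 3}

/-- The function `f_m`. It is only ever evaluated on `D_m`, where both factors of the
denominator are nonzero. -/
noncomputable def crossValue (m : ℕ) (d : Fin 4 → ℕ) : ℂ :=
  ((1 - zetaRoot m ^ d 0) * (1 - zetaRoot m ^ d 1)) /
    ((1 - zetaRoot m ^ d 2) * (1 - zetaRoot m ^ d 3))

/-- The set `𝒞`, the union of the images `f_m(D_m)` over all `m ≥ 4`. -/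
def crossValues : Set ℂ :=
  {z | ∃ m : ℕ, 4 ≤ m ∧ ∃ d ∈ quadruples m, crossValue m d = z}

/-- The first infinite family of solutions of `f_m(d) = q`:
`m = 2s`, `d = (2k, s, k, k + s)`, `q = 2`, where `s ≥ 2` and `1 ≤ k ≤ s/2`. -/
def IsTypeXII (m : ℕ) (d : Fin 4 → ℕ) (q : ℂ) : Prop :=
  ∃ s k : ℕ, 2 ≤ s ∧ m = 2 * s ∧ 1 ≤ k ∧ 2 * k ≤ s ∧ d = ![2 * k, s, k, k + s] ∧ q = 2

/-- The second infinite family of solutions of `f_m(d) = q`: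
`m = 2s`, `d = (s, 2k, k, k + s)`, `q = 2`, where `s ≥ 2` and `s/2 ≤ k < s`. -/
def IsTypeXIII (m : ℕ) (d : Fin 4 → ℕ) (q : ℂ) : Prop :=
  ∃ s k : ℕ, 2 ≤ s ∧ m = 2 * s ∧ s ≤ 2 * k ∧ k < s ∧ d = ![s, 2 * k, k, k + s] ∧ q = 2

/-- `(m, d)` arises from `(m', d')` by multiplying `m'` and all entries of `d'` by one common
positive factor. The factor is rational: passing to a multiple and cancelling a common divisor
are both allowed. -/
def IsScaling (m : ℕ) (d : Fin 4 → ℕ) (m' : ℕ) (d' : Fin 4 → ℕ) : Prop :=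
  ∃ c : ℚ, 0 < c ∧ (m : ℚ) = c * (m' : ℚ) ∧ ∀ i, (d i : ℚ) = c * (d' i : ℚ)

/-! Put x, y, z, w = ζ_m^(k₁), …, ζ_m^(k₄) and q = f_m(d). Since xy = zw, the equation f_m(d) = q is
a linear relation between six roots of unity: (1 - q) + (1 - q)xy - x - y + qz + qw = 0. Half-angle
formulas show that q is real and q > 1.

As L has finite degree, its elements lying in cyclotomic fields all lie in a single ℚ(ζ_N), and N
can be taken divisible by every prime up to 6. Then the relation has coefficients in ℚ(ζ_N) and
splits along the cosets of the N-th roots of unity (`sum_filter_div_pow_eq_one_eq_zero`). Comparing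
absolute values in the pieces (`pow_eq_one_or_eq_two`) leaves two outcomes. Either all four roots
have order dividing 2N, so d is proportional to one of the finitely many elements of D_(2N), or q =
2, w = -z and one of x, y is -1, which gives the two infinite families. -/

/-! ### Cyclotomic subfields of ℂ and their relative degrees -/

open IntermediateField in
/-- The `n`-th cyclotomic field as a subfield of `ℂ`. -/
noncomputable def cyclotomicSubfield (n : ℕ) : IntermediateField ℚ ℂ := ℚ⟮zetaRoot n⟯

theorem isPrimitiveRoot_zetaRoot {n : ℕ} (hn : n ≠ 0) : IsPrimitiveRoot (zetaRoot n) n :=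
  Complex.isPrimitiveRoot_exp n hn

theorem zetaRoot_mem_cyclotomicSubfield (n : ℕ) : zetaRoot n ∈ cyclotomicSubfield n :=
  IntermediateField.mem_adjoin_simple_self ℚ _

theorem mem_cyclotomicSubfield_of_pow_eq_one {n : ℕ} (hn : n ≠ 0) {z : ℂ} (hz : z ^ n = 1) :
    z ∈ cyclotomicSubfield n := by
  have : NeZero n := ⟨hn⟩
  obtain ⟨i, -, rfl⟩ := (isPrimitiveRoot_zetaRoot hn).eq_pow_of_pow_eq_one hz
  exact pow_mem (zetaRoot_mem_cyclotomicSubfield n) i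

theorem cyclotomicSubfield_mono {m n : ℕ} (hn : n ≠ 0) (h : m ∣ n) :
    cyclotomicSubfield m ≤ cyclotomicSubfield n := by
  have hm : m ≠ 0 := fun h0 => hn (by simpa [h0] using h)
  refine (IntermediateField.adjoin_simple_le_iff).2 (mem_cyclotomicSubfield_of_pow_eq_one hn ?_)
  exact (isPrimitiveRoot_zetaRoot hm).pow_eq_one_iff_dvd n |>.2 h

theorem finrank_cyclotomicSubfield {n : ℕ} (hn : n ≠ 0) :
    Module.finrank ℚ (cyclotomicSubfield n) = n.totient := by
  have hζ := isPrimitiveRoot_zetaRoot hn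
  rw [cyclotomicSubfield, IntermediateField.adjoin.finrank
    ((hζ.isIntegral (Nat.pos_of_ne_zero hn)).tower_top),
    ← Polynomial.cyclotomic_eq_minpoly_rat hζ (Nat.pos_of_ne_zero hn),
    Polynomial.natDegree_cyclotomic]

theorem natDegree_minpoly_zetaRoot_mul {m n : ℕ} (hn : n ≠ 0) (h : m ∣ n) :
    m.totient * (minpoly (cyclotomicSubfield m) (zetaRoot n)).natDegree = n.totient := by
  have hm : m ≠ 0 := fun h0 => hn (by simpa [h0] using h)
  have hint : IsIntegral (cyclotomicSubfield m) (zetaRoot n) :=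
    ((isPrimitiveRoot_zetaRoot hn).isIntegral (Nat.pos_of_ne_zero hn)).tower_top
  rw [← IntermediateField.adjoin.finrank hint, ← finrank_cyclotomicSubfield hm,
    Module.finrank_mul_finrank, ← finrank_cyclotomicSubfield hn]
  have : IntermediateField.restrictScalars ℚ
      (IntermediateField.adjoin (cyclotomicSubfield m) {zetaRoot n}) = cyclotomicSubfield n := by
    refine (IntermediateField.restrictScalars_adjoin ℚ (cyclotomicSubfield m) _).trans ?_
    refine le_antisymm (IntermediateField.adjoin_le_iff.2 (Set.union_subset ?_ ?_)) ?_
    · exact cyclotomicSubfield_mono hn h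
    · simpa using zetaRoot_mem_cyclotomicSubfield n
    · exact IntermediateField.adjoin.mono _ _ _ Set.subset_union_right
  rw [← this]
  rfl

theorem natDegree_minpoly_zetaRoot_of_dvd {p m : ℕ} (hp : p.Prime) (hm : m ≠ 0) (h : p ∣ m) :
    (minpoly (cyclotomicSubfield m) (zetaRoot (p * m))).natDegree = p := by
  have := natDegree_minpoly_zetaRoot_mul (mul_ne_zero hp.ne_zero hm) (Dvd.intro_left p rfl)
  rw [Nat.totient_mul_of_prime_of_dvd hp h, mul_comm] at this
  exact Nat.eq_of_mul_eq_mul_right (Nat.totient_pos.2 (Nat.pos_of_ne_zero hm)) this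

theorem le_natDegree_minpoly_zetaRoot {p m : ℕ} (hp : p.Prime) (hm : m ≠ 0) :
    p - 1 ≤ (minpoly (cyclotomicSubfield m) (zetaRoot (p * m))).natDegree := by
  by_cases h : p ∣ m
  · rw [natDegree_minpoly_zetaRoot_of_dvd hp hm h]
    exact Nat.sub_le p 1
  have := natDegree_minpoly_zetaRoot_mul (mul_ne_zero hp.ne_zero hm) (Dvd.intro_left p rfl)
  rw [Nat.totient_mul_of_prime_of_not_dvd hp h, mul_comm] at this
  exact (Nat.eq_of_mul_eq_mul_right (Nat.totient_pos.2 (Nat.pos_of_ne_zero hm)) this).ge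

/-! ### Splitting linear relations between roots of unity -/

/-- Powers of `z` below the degree of `z` over an intermediate field are linearly independent. -/
theorem eq_zero_of_sum_mul_pow_eq_zero {K : Type*} [Field K] [Algebra K ℂ]
    (F : IntermediateField K ℂ) (z : ℂ) {r : ℕ} (hr : r ≤ (minpoly F z).natDegree) (a : ℕ → ℂ)
    (ha : ∀ j, a j ∈ F) (hsum : ∑ j ∈ Finset.range r, a j * z ^ j = 0) :
    ∀ j < r, a j = 0 := by
  intro j hj
  have hli := (Fintype.linearIndependent_iff.1
    ((linearIndependent_pow (K := F) z).comp (Fin.castLE hr) (Fin.castLE_injective hr)))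
    (fun i => ⟨a i, ha i⟩) (by
      simpa [Finset.sum_range, Algebra.smul_def] using hsum) ⟨j, hj⟩
  simpa using congrArg Subtype.val hli

/-- Fewer than p exponents miss some residue b, and a shift moves b to p - 1. This is needed when p
∤ m, where only p - 1 consecutive powers of `zetaRoot (p * m)` are independent over the m-th
cyclotomic field. -/
theorem exists_forall_add_mod_lt {ι : Type*} (s : Finset ι) (e : ι → ℕ) {p : ℕ} (hp : 0 < p)
    (hs : s.card < p) : ∃ t, ∀ i ∈ s, (e i + t) % p < p - 1 := by
  obtain ⟨b, hb, hb'⟩ : ∃ b ∈ Finset.range p, b ∉ s.image (fun i => e i % p) := by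
    by_contra! hcon
    have := Finset.card_le_card (show Finset.range p ⊆ _ from hcon)
    rw [Finset.card_range] at this
    exact absurd (this.trans Finset.card_image_le) (by omega)
  rw [Finset.mem_range] at hb
  refine ⟨p - 1 - b, fun i hi => ?_⟩
  have hne : (e i + (p - 1 - b)) % p ≠ p - 1 := by
    intro h
    apply hb'
    rw [Finset.mem_image]
    refine ⟨i, hi, ?_⟩
    have h1 : (e i + (p - 1 - b) + (b + 1)) % p = e i % p := by
      rw [show e i + (p - 1 - b) + (b + 1) = e i + p by omega, Nat.add_mod_right]
    rw [Nat.add_mod, h] at h1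
    rw [← h1]
    rcases Nat.lt_or_ge (b + 1) p with h2 | h2
    · rw [Nat.mod_eq_of_lt h2, show p - 1 + (b + 1) = b + p by omega, Nat.add_mod_right,
        Nat.mod_eq_of_lt hb]
    · rw [show b + 1 = p by omega, Nat.mod_self, add_zero, Nat.mod_eq_of_lt (by omega)]
      omega
  have := Nat.mod_lt (e i + (p - 1 - b)) hp
  omega

/-- With ζ = `zetaRoot (p * m)`, the power ζ^p already lies in the m-th field, so each term is a
coefficient times ζ^(e mod p). After multiplication by a suitable ζ^t these residues stay below the
degree of ζ, and independence kills each residue class separately. -/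
theorem sum_filter_mod_eq_zero {ι : Type*} {p m : ℕ} (hp : p.Prime) (hm : m ≠ 0) (s : Finset ι)
    (c : ι → ℂ) (hc : ∀ i, c i ∈ cyclotomicSubfield m) (e : ι → ℕ) (hs : s.card < p ∨ p ∣ m)
    (hsum : ∑ i ∈ s, c i * zetaRoot (p * m) ^ e i = 0) (i : ι) (hi : i ∈ s) :
    ∑ j ∈ s with e j % p = e i % p, c j * zetaRoot (p * m) ^ e j = 0 := by
  set ζ := zetaRoot (p * m) with hζ
  have hprim : IsPrimitiveRoot ζ (p * m) := isPrimitiveRoot_zetaRoot (mul_ne_zero hp.ne_zero hm)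
  have hζ0 : ζ ≠ 0 := hprim.ne_zero (mul_ne_zero hp.ne_zero hm)
  obtain ⟨r, t, hr, ht⟩ : ∃ r t, r ≤ (minpoly (cyclotomicSubfield m) ζ).natDegree ∧
      ∀ i ∈ s, (e i + t) % p < r := by
    rcases hs with hs | hs
    · obtain ⟨t, ht⟩ := exists_forall_add_mod_lt s e hp.pos hs
      exact ⟨p - 1, t, le_natDegree_minpoly_zetaRoot hp hm, ht⟩
    · exact ⟨p, 0, (natDegree_minpoly_zetaRoot_of_dvd hp hm hs).ge,
        fun i _ => Nat.mod_lt _ hp.pos⟩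
  have hmem : ∀ k, (ζ ^ p) ^ k ∈ cyclotomicSubfield m := fun k =>
    pow_mem (mem_cyclotomicSubfield_of_pow_eq_one hm
      (by rw [← pow_mul, hprim.pow_eq_one])) k
  have hsplit : ∀ j, ζ ^ (e j + t) = (ζ ^ p) ^ ((e j + t) / p) * ζ ^ ((e j + t) % p) := by
    intro j
    rw [← pow_mul, ← pow_add, Nat.div_add_mod]
  have key := eq_zero_of_sum_mul_pow_eq_zero (cyclotomicSubfield m) ζ hr
    (fun l => ∑ j ∈ s with (e j + t) % p = l, c j * (ζ ^ p) ^ ((e j + t) / p))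
    (fun l => sum_mem fun j _ => mul_mem (hc j) (hmem _)) (by
      have h1 : ∑ j ∈ s, c j * ζ ^ (e j + t) = 0 := by
        simp_rw [pow_add, ← mul_assoc, ← Finset.sum_mul, hsum, zero_mul]
      rw [← h1, ← Finset.sum_fiberwise_of_maps_to (s := s) (t := Finset.range r)
        (g := fun j => (e j + t) % p) (fun j hj => Finset.mem_range.2 (ht j hj))]
      refine Finset.sum_congr rfl fun l _ => ?_
      rw [Finset.sum_mul]
      refine Finset.sum_congr rfl fun j hj => ?_
      rw [hsplit j, (Finset.mem_filter.1 hj).2, mul_assoc]) _ (ht i hi)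
  have hfilter : ∀ j, (e j + t) % p = (e i + t) % p ↔ e j % p = e i % p := fun j =>
    ⟨fun h => Nat.ModEq.add_right_cancel' t h, fun h => Nat.ModEq.add_right t h⟩
  simp only [hfilter] at key
  have h2 : (∑ j ∈ s with e j % p = e i % p, c j * ζ ^ e j) * ζ ^ t = 0 := by
    rw [Finset.sum_mul, ← zero_mul (ζ ^ ((e i + t) % p)), ← key, Finset.sum_mul]
    refine Finset.sum_congr rfl fun j hj => ?_
    rw [mul_assoc, ← pow_add, hsplit j, (hfilter j).2 (Finset.mem_filter.1 hj).2, mul_assoc]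
  exact (mul_eq_zero.1 h2).resolve_right (pow_ne_zero _ hζ0)

/-- If at most `k` roots of unity satisfy a linear relation over the `N`-th cyclotomic field, and
every prime up to `k` divides `N`, then the relation splits along the cosets of the group of
`N`-th roots of unity. -/
theorem sum_filter_div_pow_eq_one_eq_zero {ι : Type*} {N k : ℕ}
    (hk : ∀ p : ℕ, p.Prime → p ≤ k → p ∣ N) (c : ι → ℂ)
    (hc : ∀ i, c i ∈ cyclotomicSubfield N) {M : ℕ} (hM : M ≠ 0) (hNM : N ∣ M) :
    ∀ (s : Finset ι) (η : ι → ℂ), s.card ≤ k → (∀ i, η i ^ M = 1) →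
      ∑ i ∈ s, c i * η i = 0 →
      ∀ i ∈ s, ∑ j ∈ s with (η j / η i) ^ N = 1, c j * η j = 0 := by
  have hN : N ≠ 0 := fun h => hM (by simpa [h] using hNM)
  obtain ⟨d, rfl⟩ := hNM
  -- The primes of M / N are removed one at a time.
  induction d using induction_on_primes with
  | zero => simp at hM
  | one =>
    intro s η _ hη hsum i _
    rw [Finset.filter_true_of_mem, hsum]
    intro j _
    rw [mul_one] at hη
    rw [div_pow, hη, hη, div_one]
  | prime_mul p a hp ih =>
    intro s η hs hη hsum i hi
    have hm : N * a ≠ 0 := fun h => hM (by rw [mul_left_comm, h, mul_zero])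
    rw [mul_left_comm] at hM hη
    have : NeZero (p * (N * a)) := ⟨hM⟩
    have hprim := isPrimitiveRoot_zetaRoot hM
    set ζ := zetaRoot (p * (N * a)) with hζ
    have hζ0 : ζ ≠ 0 := hprim.ne_zero hM
    choose e _ he using fun j => hprim.eq_pow_of_pow_eq_one (hη j)
    obtain rfl : (fun j => ζ ^ e j) = η := funext he
    have hcard : s.card < p ∨ p ∣ N * a := by
      rcases Nat.lt_or_ge k p with h | h
      · exact Or.inl (hs.trans_lt h)
      · exact Or.inr ((hk p hp h).mul_right a)
    have hcoset := sum_filter_mod_eq_zero hp hm s c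
      (fun j => cyclotomicSubfield_mono hm (Dvd.intro a rfl) (hc j)) e hcard hsum i hi
    rw [← hζ] at hcoset
    set s' := s.filter fun j => e j % p = e i % p with hs'
    have hi' : i ∈ s' := Finset.mem_filter.2 ⟨hi, rfl⟩
    have hsplit : ∀ j ∈ s', ζ ^ e j = ζ ^ (p * (e j / p)) * ζ ^ (e i % p) := by
      intro j hj
      rw [← pow_add, ← (Finset.mem_filter.1 hj).2, Nat.div_add_mod]
    have hr0 : ζ ^ (e i % p) ≠ 0 := pow_ne_zero _ hζ0
    -- Within one residue class mod p, dividing by the common factor ζ^(e i % p) leaves (N * a)-th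
    -- roots of unity.
    have hstep := ih hm s' (fun j => ζ ^ (p * (e j / p)))
      ((Finset.card_filter_le _ _).trans hs)
      (fun j => by
        rw [← pow_mul, mul_right_comm, pow_mul, hprim.pow_eq_one, one_pow])
      ((mul_eq_zero.1 (by
        rw [← hcoset, Finset.sum_mul]
        exact Finset.sum_congr rfl fun j hj => by rw [hsplit j hj, mul_assoc])).resolve_right hr0)
      i hi'
    -- A coset of the N-th roots of unity stays inside one residue class mod p: a quotient of order
    -- dividing N * a forces congruent exponents.
    have hfilter : (s.filter fun j => (ζ ^ e j / ζ ^ e i) ^ N = 1) =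
        s'.filter fun j => (ζ ^ (p * (e j / p)) / ζ ^ (p * (e i / p))) ^ N = 1 := by
      have hquot : ∀ j ∈ s', ζ ^ e j / ζ ^ e i =
          ζ ^ (p * (e j / p)) / ζ ^ (p * (e i / p)) := by
        intro j hj
        rw [hsplit j hj, hsplit i hi', mul_div_mul_right _ _ hr0]
      ext j
      rw [Finset.mem_filter, Finset.mem_filter]
      constructor
      · rintro ⟨hj, h⟩
        have hj' : j ∈ s' := by
          refine Finset.mem_filter.2 ⟨hj, ?_⟩
          have h1 : ζ ^ (e j * (N * a)) = ζ ^ (e i * (N * a)) := by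
            rw [div_pow, div_eq_one_iff_eq (pow_ne_zero _ (pow_ne_zero _ hζ0))] at h
            rw [← mul_assoc, ← mul_assoc, pow_mul, pow_mul _ _ a, pow_mul, pow_mul _ _ N, h]
          have h2 : ζ ^ ((e j * (N * a) : ℕ) - (e i * (N * a) : ℕ) : ℤ) = 1 := by
            rw [zpow_sub₀ hζ0, zpow_natCast, zpow_natCast, h1, div_self (pow_ne_zero _ hζ0)]
          rw [hprim.zpow_eq_one_iff_dvd] at h2
          exact Nat.ModEq.mul_right_cancel' hm (Nat.modEq_iff_dvd.2 h2).symm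
        exact ⟨hj', hquot j hj' ▸ h⟩
      · rintro ⟨hj, h⟩
        exact ⟨(Finset.mem_filter.1 hj).1, by rwa [hquot j hj]⟩
    rw [hfilter]
    rw [← zero_mul (ζ ^ (e i % p)), ← hstep, Finset.sum_mul]
    refine Finset.sum_congr rfl fun j hj => ?_
    change c j * ζ ^ e j = _
    rw [hsplit j (Finset.mem_filter.1 hj).1, mul_assoc]

/-- The subspaces L ∩ ℚ(ζ_(n!)) increase with n, hence stabilize in the finite-dimensional L, and
every ℚ(ζ_m) lies in ℚ(ζ_(m!)). -/
theorem exists_cyclotomicSubfield_of_finiteDimensional (L : IntermediateField ℚ ℂ)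
    [FiniteDimensional ℚ L] (k : ℕ) :
    ∃ n, k ≤ n ∧ ∀ m ≠ 0, ∀ z ∈ L, z ∈ cyclotomicSubfield m → z ∈ cyclotomicSubfield n.factorial := by
  let f : ℕ →o Submodule ℚ L :=
    ⟨fun n => (Subalgebra.toSubmodule (cyclotomicSubfield n.factorial).toSubalgebra).comap
      L.val.toLinearMap, fun a b hab => Submodule.comap_mono
        (cyclotomicSubfield_mono (Nat.factorial_ne_zero b) (Nat.factorial_dvd_factorial hab))⟩
  obtain ⟨n, hn⟩ := monotone_stabilizes_iff_noetherian.2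
    (inferInstance : IsNoetherian ℚ L) f
  refine ⟨max n k, le_max_right n k, fun m hm z hz hzm => ?_⟩
  have h1 : (⟨z, hz⟩ : L) ∈ f (max n (max k m)) := by
    refine cyclotomicSubfield_mono (Nat.factorial_ne_zero _)
      (Nat.dvd_factorial (Nat.pos_of_ne_zero hm) ?_) hzm
    exact (le_max_right k m).trans (le_max_right _ _)
  rw [← hn _ (le_max_left _ _), hn _ (le_max_left n k)] at h1
  exact h1

/-! ### The six-term relation -/

/-- A coset of the N-th roots of unity is labelled by the common N-th power u of its elements; six
terms explain the bound 6 on the primes. -/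
theorem sum_ite_pow_eq_zero {N M : ℕ} (hprimes : ∀ p : ℕ, p.Prime → p ≤ 6 → p ∣ N) (hM : M ≠ 0)
    (hNM : N ∣ M) {q x y z w : ℂ} (hq : q ∈ cyclotomicSubfield N) (hx : x ^ M = 1)
    (hy : y ^ M = 1) (hz : z ^ M = 1) (hw : w ^ M = 1) (hxy : x * y = z * w)
    (h : (1 - x) * (1 - y) = q * ((1 - z) * (1 - w))) {u : ℂ}
    (hu : u = 1 ∨ u = x ^ N ∨ u = y ^ N ∨ u = z ^ N ∨ u = w ^ N) :
    (if 1 = u then 1 - q else 0) + (if x ^ N * y ^ N = u then (1 - q) * (x * y) else 0) +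
      (if x ^ N = u then -x else 0) + (if y ^ N = u then -y else 0) +
      (if z ^ N = u then q * z else 0) + (if w ^ N = u then q * w else 0) = 0 := by
  have key := sum_filter_div_pow_eq_one_eq_zero (ι := Fin 6) hprimes
    ![1 - q, 1 - q, -1, -1, q, q] (by
      intro i
      fin_cases i
      · exact sub_mem (one_mem _) hq
      · exact sub_mem (one_mem _) hq
      · exact neg_mem (one_mem _)
      · exact neg_mem (one_mem _)
      · exact hq
      · exact hq) hM hNM Finset.univ ![1, x * y, x, y, z, w] (by simp) (by
      intro i
      fin_cases i <;> simp [hx, hy, hz, hw, mul_pow]) (by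
      simp only [Fin.sum_univ_six]
      simp
      linear_combination h - q * hxy)
  have hne : ∀ v : ℂ, v ^ M = 1 → v ≠ 0 := by
    rintro _ hv rfl
    simp [hM] at hv
  have hi : ∃ i : Fin 6, u = (![1, x * y, x, y, z, w] i) ^ N ∧
      (![1, x * y, x, y, z, w] i) ≠ 0 := by
    rcases hu with rfl | rfl | rfl | rfl | rfl
    · exact ⟨0, by simp⟩
    · exact ⟨2, by simpa using hne x hx⟩
    · exact ⟨3, by simpa using hne y hy⟩
    · exact ⟨4, by simpa using hne z hz⟩
    · exact ⟨5, by simpa using hne w hw⟩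
  obtain ⟨i, rfl, hi0⟩ := hi
  have := key i (Finset.mem_univ i)
  simp only [div_pow, div_eq_one_iff_eq (pow_ne_zero N hi0)] at this
  rw [Finset.sum_filter, Fin.sum_univ_six] at this
  simp only [Matrix.cons_val, one_pow, mul_pow, mul_one, neg_one_mul] at this
  convert this using 1
  congr!

/-- This is the case where z is an N-th root of unity; capitals stand for N-th powers. The class of
1 then holds 1 - q and qz, and the excluded short relations force X = Y = 1 or XY = 1. If XY = 1
with X ≠ 1, then -x needs a partner in its class, so Y = X. -/
theorem sq_eq_one_of_class_eq_one {q x y z w X Y W : ℂ} (hx0 : x ≠ 0)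
    (hS : X * Y = W) (no1 : 1 - q + q * z ≠ 0) (no3 : 1 - q + -x + q * z ≠ 0)
    (no3' : 1 - q + -y + q * z ≠ 0)
    (hsum : ∀ u, u = 1 ∨ u = X → (if 1 = u then 1 - q else 0) +
      (if X * Y = u then (1 - q) * (x * y) else 0) +
      (if X = u then -x else 0) + (if Y = u then -y else 0) +
      (if 1 = u then q * z else 0) + (if W = u then q * w else 0) = 0) :
    X ^ 2 = 1 ∧ Y ^ 2 = 1 ∧ W ^ 2 = 1 := by
  subst hS
  have s1 := hsum 1 (Or.inl rfl)
  have sX := hsum X (Or.inr rfl)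
  by_cases hX : X = 1
  · subst hX
    by_cases hY : Y = 1
    · simp [hY]
    · simp [hY] at s1
      exact absurd s1 no3
  by_cases hY : Y = 1
  · subst hY
    simp [hX] at s1
    exact absurd (by linear_combination s1) no3'
  by_cases hW : X * Y = 1
  · by_cases hXY : Y = X
    · subst hXY
      simp [hW, sq]
    · simp [hW, Ne.symm hX, hXY, hx0] at sX
  · simp [hX, hY, hW] at s1
    exact absurd s1 no1

theorem pow_eq_one_or_eq_two {N M : ℕ} (hprimes : ∀ p : ℕ, p.Prime → p ≤ 6 → p ∣ N) (hM : M ≠ 0)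
    (hNM : N ∣ M) {q : ℝ} (hq1 : 1 < q) {x y z w : ℂ} (hq : (q : ℂ) ∈ cyclotomicSubfield N)
    (hx : x ^ M = 1) (hy : y ^ M = 1) (hz : z ^ M = 1) (hw : w ^ M = 1)
    (hx1 : x ≠ 1) (hy1 : y ≠ 1) (hxz : x ≠ z) (hxw : x ≠ w) (hxy : x * y = z * w)
    (h : (1 - x) * (1 - y) = q * ((1 - z) * (1 - w))) :
    (x ^ (2 * N) = 1 ∧ y ^ (2 * N) = 1 ∧ z ^ (2 * N) = 1 ∧ w ^ (2 * N) = 1) ∨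
      (q = 2 ∧ (x = -1 ∨ y = -1) ∧ w = -z) := by
  have hsum := fun u => sum_ite_pow_eq_zero (u := u) hprimes hM hNM hq hx hy hz hw hxy h
  have hS : x ^ N * y ^ N = z ^ N * w ^ N := by rw [← mul_pow, ← mul_pow, hxy]
  have hnorm : ∀ v : ℂ, v ^ M = 1 → ‖v‖ = 1 := fun v hv => Complex.norm_eq_one_of_pow_eq_one hv hM
  have hne : ∀ v : ℂ, v ^ M = 1 → v ≠ 0 := fun v hv h0 => by simpa [h0] using hnorm v hv
  have nx := hnorm x hx
  have ny := hnorm y hy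
  have nz := hnorm z hz
  have nw := hnorm w hw
  have x0 := hne x hx
  have y0 := hne y hy
  have z0 := hne z hz
  have hqC0 : (q : ℂ) ≠ 0 := by exact_mod_cast (by linarith : q ≠ 0)
  have hqC1 : (1 - q : ℂ) ≠ 0 := sub_ne_zero.2 (by exact_mod_cast hq1.ne)
  have nq : ‖(q : ℂ)‖ = q := by rw [Complex.norm_real, Real.norm_of_nonneg (by linarith)]
  have nq1 : ‖(1 - q : ℂ)‖ = q - 1 := by
    rw [← norm_neg, neg_sub, show (q - 1 : ℂ) = ((q - 1 : ℝ) : ℂ) by push_cast; ring,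
      Complex.norm_real, Real.norm_of_nonneg (by linarith)]
  -- No two-term relation joins `1` or `x`, `y` with `z`, `w`.
  have no1 : ∀ v : ℂ, ‖v‖ = 1 → 1 - q + q * v ≠ 0 := by
    intro v hv h0
    have : ‖(q : ℂ) * v‖ = ‖(1 - q : ℂ)‖ := by
      rw [← norm_neg (1 - q : ℂ)]
      congr 1
      linear_combination h0
    rw [norm_mul, nq, nq1, hv] at this
    linarith
  have no2 : ∀ u v : ℂ, ‖u‖ = 1 → ‖v‖ = 1 → -u + q * v ≠ 0 := by
    intro u v hu hv h0
    have : ‖(q : ℂ) * v‖ = ‖u‖ := by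
      congr 1
      linear_combination h0
    rw [norm_mul, nq, hu, hv] at this
    linarith
  have two : ∀ v : ℂ, ‖v‖ = 1 → 1 - q + -v = 0 → q = 2 ∧ v = -1 := by
    intro v hv h0
    have h1 : v = 1 - q := by linear_combination -h0
    rw [h1, nq1] at hv
    have hq2 : q = 2 := by linarith
    refine ⟨hq2, ?_⟩
    rw [h1, hq2]
    norm_num
  have hsq : ∀ v : ℂ, v ^ (2 * N) = (v ^ N) ^ 2 := fun v => by rw [mul_comm, pow_mul]
  simp only [hsq]
  have hX0 : x ^ N ≠ 0 := pow_ne_zero _ x0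
  have hY0 : y ^ N ≠ 0 := pow_ne_zero _ y0
  have hZ0 : z ^ N ≠ 0 := pow_ne_zero _ z0
  have s1 := hsum 1 (by simp)
  have sX := hsum (x ^ N) (by simp)
  have sZ := hsum (z ^ N) (by simp)
  -- A three-term relation `1 - x = q (1 - z)` forces `y = w`.
  have no3 : ∀ x y z w : ℂ, x * y = z * w → (1 - x) * (1 - y) = q * ((1 - z) * (1 - w)) →
      x ≠ 1 → x ≠ z → y ≠ 0 → 1 - q + -x + q * z ≠ 0 := by
    intro x y z w hxy h hx1 hxz hy0 h0
    have h1 : (1 - x) * (w - y) = 0 := by linear_combination h - (1 - w) * h0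
    rcases mul_eq_zero.1 h1 with h1 | h1
    · exact hx1 (sub_eq_zero.1 h1).symm
    · rw [sub_eq_zero.1 h1] at hxy
      exact hxz (mul_right_cancel₀ hy0 hxy)
  have hyz : y ≠ z := fun h0 => hxw (mul_left_cancel₀ y0 (by rw [mul_comm, hxy, h0]))
  have hyw : y ≠ w := fun h0 => hxz (mul_right_cancel₀ y0 (by rw [hxy, h0]))
  have hyx : y * x = z * w := by rw [mul_comm, hxy]
  have hwz : x * y = w * z := by rw [hxy, mul_comm]
  have hyx' : y * x = w * z := by rw [hyx, mul_comm]
  have n1 := no3 x y z w hxy h hx1 hxz y0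
  have n2 := no3 y x z w hyx (by linear_combination h) hy1 hyz x0
  have n3 := no3 x y w z hwz (by linear_combination h) hx1 hxw y0
  have n4 := no3 y x w z hyx' (by linear_combination h) hy1 hyw x0
  generalize x ^ N = X at *
  generalize y ^ N = Y at *
  generalize z ^ N = Z at *
  generalize w ^ N = W at *
  by_cases hZ : Z = 1
  · subst hZ
    obtain ⟨h1, h2, h3⟩ := sq_eq_one_of_class_eq_one (q := q) (x := x) (y := y) (z := z) (w := w)
      x0 (hS.trans (one_mul W)) (no1 z nz) n1 n2 (fun u hu => hsum u (by tauto))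
    exact Or.inl ⟨h1, h2, one_pow 2, h3⟩
  by_cases hW : W = 1
  · subst hW
    obtain ⟨h1, h2, h3⟩ := sq_eq_one_of_class_eq_one (q := q) (x := x) (y := y) (z := w) (w := z)
      x0 (hS.trans (mul_one Z)) (no1 w nw) n3 n4
      (fun u hu => by linear_combination hsum u (by tauto))
    exact Or.inl ⟨h1, h2, h3, one_pow 2⟩
  by_cases hZW : Z = W
  · subst hZW
    by_cases hX : X = Z
    · subst hX
      obtain rfl := mul_left_cancel₀ hX0 hS
      by_cases h1 : Y * Y = 1
      · rw [← pow_two] at h1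
        exact Or.inl ⟨h1, h1, h1, h1⟩
      · simp [h1, hZ, hqC1] at s1
    have hY : Y ≠ Z := fun h0 => hX (by rw [h0] at hS; exact mul_right_cancel₀ hZ0 hS)
    -- The class of z is {z, w}: it omits xy, since Z * Z = Z would give Z = 1.
    have hwz : w = -z := by
      simp [hS, hX, hY, Ne.symm hZ, hZ, hZ0] at sZ
      exact mul_left_cancel₀ hqC0 (by linear_combination sZ)
    by_cases hX1 : X = 1
    · subst hX1
      by_cases hY1 : Y = 1
      · left
        rw [pow_two Z, ← hS, hY1]
        simp
      · simp [hZ, hY1] at s1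
        obtain ⟨h1, h2⟩ := two x nx s1
        exact Or.inr ⟨h1, Or.inl h2, hwz⟩
    by_cases hY1 : Y = 1
    · subst hY1
      simp [hZ, hX1] at s1
      obtain ⟨h1, h2⟩ := two y ny s1
      exact Or.inr ⟨h1, Or.inr h2, hwz⟩
    by_cases h1 : X * Y = 1
    · by_cases hXY : Y = X
      · subst hXY
        have hZ2 : Z ^ 2 = 1 := by rw [pow_two, ← hS, h1]
        rw [← pow_two] at h1
        exact Or.inl ⟨h1, h1, hZ2, hZ2⟩
      · simp [h1, Ne.symm hX1, hXY, Ne.symm hX, x0] at sX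
    · simp [h1, hX1, hY1, hZ, hqC1] at s1
  -- Now 1, Z, W are distinct, so qz can only be cancelled by one of -x, -y, against q > 1.
  exfalso
  by_cases hX : X = Z
  · subst hX
    obtain rfl := mul_left_cancel₀ hX0 hS
    simp [Ne.symm hZ, hW, Ne.symm hZW, hZ0] at sZ
    exact no2 x z nx nz sZ
  by_cases hY : Y = Z
  · subst hY
    obtain rfl := mul_left_cancel₀ hY0 ((mul_comm Y X).trans hS)
    simp [Ne.symm hZ, hW, Ne.symm hZW, hZ0] at sZ
    exact no2 y z ny nz sZ
  simp [hS, Ne.symm hZ, hW, Ne.symm hZW, hZ0, hX, hY, hqC0, z0] at sZ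

/-! ### Quadruples: scaling, sine formula, finiteness -/

theorem zetaRoot_pow (m k : ℕ) :
    zetaRoot m ^ k = Complex.exp (2 * (Real.pi : ℂ) * Complex.I * ((k / m : ℚ) : ℂ)) := by
  rw [zetaRoot, ← Complex.exp_nat_mul]
  congr 1
  push_cast
  ring

theorem IsScaling.zetaRoot_pow_eq {m m' : ℕ} {d d' : Fin 4 → ℕ} (h : IsScaling m d m' d')
    (i : Fin 4) : zetaRoot m ^ d i = zetaRoot m' ^ d' i := by
  obtain ⟨c, hc, hm, hd⟩ := h
  rw [zetaRoot_pow, zetaRoot_pow, hm, hd, mul_div_mul_left _ _ hc.ne']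

theorem IsScaling.crossValue_eq {m m' : ℕ} {d d' : Fin 4 → ℕ} (h : IsScaling m d m' d') :
    crossValue m d = crossValue m' d' := by
  simp only [crossValue, h.zetaRoot_pow_eq]

theorem one_sub_zetaRoot_pow (m k : ℕ) :
    1 - zetaRoot m ^ k = -2 * Complex.I * Complex.exp ((Real.pi * k / m : ℝ) * Complex.I) *
      (Real.sin (Real.pi * k / m) : ℝ) := by
  have h1 : zetaRoot m ^ k = Complex.exp ((Real.pi * k / m : ℝ) * Complex.I) *
      Complex.exp ((Real.pi * k / m : ℝ) * Complex.I) := by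
    rw [zetaRoot, ← Complex.exp_nat_mul, ← Complex.exp_add]
    congr 1
    push_cast
    ring
  have h2 : Complex.exp ((Real.pi * k / m : ℝ) * Complex.I) *
      Complex.exp (-(Real.pi * k / m : ℝ) * Complex.I) = 1 := by
    rw [← Complex.exp_add, neg_mul, add_neg_cancel, Complex.exp_zero]
  rw [h1, Complex.ofReal_sin, Complex.sin]
  linear_combination -h2 + Complex.exp ((Real.pi * k / m : ℝ) * Complex.I) *
    (Complex.exp (-(Real.pi * k / m : ℝ) * Complex.I) -
      Complex.exp ((Real.pi * k / m : ℝ) * Complex.I)) * Complex.I_mul_I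

/-- By product-to-sum, equal sums reduce the claim to cos (d - c) < cos (b - a), and cosine
decreases on [0, π]. -/
theorem sin_mul_sin_lt_sin_mul_sin {a b c d : ℝ} (hsum : a + b = c + d) (hc : 0 ≤ c)
    (hca : c < a) (hab : a ≤ b) (hd : d ≤ Real.pi) :
    Real.sin c * Real.sin d < Real.sin a * Real.sin b := by
  have h1 : Real.cos (d - c) < Real.cos (b - a) :=
    Real.cos_lt_cos_of_nonneg_of_le_pi (by linarith) (by linarith) (by linarith)
  have h2 : Real.cos (a + b) = Real.cos (c + d) := by rw [hsum]
  rw [Real.cos_sub, Real.cos_sub] at h1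
  rw [Real.cos_add, Real.cos_add] at h2
  linarith

theorem exists_one_lt_crossValue_eq {m : ℕ} {d : Fin 4 → ℕ} (hd : d ∈ quadruples m) :
    ∃ q : ℝ, 1 < q ∧ crossValue m d = q := by
  obtain ⟨h2, h20, h01, h13, h3, hsum⟩ := hd
  have hm : (0 : ℝ) < m := by exact_mod_cast (by omega : 0 < m)
  have hpos : ∀ k : ℕ, 0 < k → k < m → 0 < Real.sin (Real.pi * k / m) := by
    intro k hk hkm
    have hk' : (0 : ℝ) < k := by exact_mod_cast hk
    have hkm' : (k : ℝ) < m := by exact_mod_cast hkm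
    refine Real.sin_pos_of_pos_of_lt_pi (by positivity) ?_
    rw [div_lt_iff₀ hm]
    exact mul_lt_mul_of_pos_left hkm' Real.pi_pos
  have hc := hpos (d 2) h2 (by omega)
  have hd := hpos (d 3) (by omega) h3
  have hsumR : (d 0 : ℝ) + d 1 = d 2 + d 3 := by exact_mod_cast hsum
  have harg : Real.pi * d 0 / m + Real.pi * d 1 / m = Real.pi * d 2 / m + Real.pi * d 3 / m := by
    rw [← add_div, ← add_div, ← mul_add, ← mul_add, hsumR]
  refine ⟨Real.sin (Real.pi * d 0 / m) * Real.sin (Real.pi * d 1 / m) /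
    (Real.sin (Real.pi * d 2 / m) * Real.sin (Real.pi * d 3 / m)), ?_, ?_⟩
  · rw [one_lt_div (mul_pos hc hd)]
    have hpi := Real.pi_pos
    refine sin_mul_sin_lt_sin_mul_sin harg (by positivity) ?_ ?_ ?_
    · gcongr
    · gcongr
    · rw [div_le_iff₀ hm]
      gcongr
  -- The half-angle phases cancel because k₁ + k₂ = k₃ + k₄.
  · have hexp : Complex.exp ((Real.pi * d 0 / m : ℝ) * Complex.I) *
        Complex.exp ((Real.pi * d 1 / m : ℝ) * Complex.I) =
        Complex.exp ((Real.pi * d 2 / m : ℝ) * Complex.I) *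
        Complex.exp ((Real.pi * d 3 / m : ℝ) * Complex.I) := by
      rw [← Complex.exp_add, ← Complex.exp_add, ← add_mul, ← add_mul, ← Complex.ofReal_add,
        ← Complex.ofReal_add, harg]
    have hc' : (Real.sin (Real.pi * d 2 / m) : ℂ) ≠ 0 := Complex.ofReal_ne_zero.2 hc.ne'
    have hd' : (Real.sin (Real.pi * d 3 / m) : ℂ) ≠ 0 := Complex.ofReal_ne_zero.2 hd.ne'
    have hI : ∀ t : ℂ, -2 * Complex.I * Complex.exp t ≠ 0 := fun t => by simp
    simp only [crossValue, one_sub_zetaRoot_pow]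
    rw [Complex.ofReal_div (Real.sin _ * _), Complex.ofReal_mul (Real.sin _),
      Complex.ofReal_mul (Real.sin _),
      div_eq_div_iff (mul_ne_zero (mul_ne_zero (hI _) hc') (mul_ne_zero (hI _) hd'))
        (mul_ne_zero hc' hd')]
    linear_combination (-2 * Complex.I) ^ 2 *
      (Real.sin (Real.pi * d 0 / m) : ℂ) * (Real.sin (Real.pi * d 1 / m) : ℂ) *
      (Real.sin (Real.pi * d 2 / m) : ℂ) * (Real.sin (Real.pi * d 3 / m) : ℂ) * hexp

theorem crossValue_mem_cyclotomicSubfield (m : ℕ) (d : Fin 4 → ℕ) :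
    crossValue m d ∈ cyclotomicSubfield m := by
  have h : ∀ i, 1 - zetaRoot m ^ d i ∈ cyclotomicSubfield m := fun i =>
    sub_mem (one_mem _) (pow_mem (zetaRoot_mem_cyclotomicSubfield m) _)
  exact div_mem (mul_mem (h 0) (h 1)) (mul_mem (h 2) (h 3))

theorem finite_quadruples (m : ℕ) : (quadruples m).Finite := by
  refine (Set.finite_Iic (fun _ : Fin 4 => m)).subset fun d hd => ?_
  obtain ⟨h2, h20, h01, h13, h3, hsum⟩ := hd
  rw [Set.mem_Iic, Pi.le_def]
  intro i
  fin_cases i <;> simp only [Fin.zero_eta, Fin.mk_one, Fin.reduceFinMk] <;> omega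

/-- If all entries of `(ζ_m ^ d i)` are `n`-th roots of unity, `(m, d)` is proportional to a
quadruple of `D_n`. -/
theorem exists_isScaling_of_pow_eq_one {m n : ℕ} {d : Fin 4 → ℕ} (hd : d ∈ quadruples m)
    (hn : n ≠ 0) (h : ∀ i, (zetaRoot m ^ d i) ^ n = 1) :
    ∃ d' ∈ quadruples n, IsScaling m d n d' := by
  obtain ⟨h2, h20, h01, h13, h3, hsum⟩ := hd
  have hm : 0 < m := by omega
  have hdvd : ∀ i, ∃ k, d i * n = m * k := fun i => by
    have := h i
    rwa [← pow_mul, (isPrimitiveRoot_zetaRoot hm.ne').pow_eq_one_iff_dvd] at this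
  choose d' hd' using hdvd
  have hn' : 0 < n := Nat.pos_of_ne_zero hn
  have hlt : ∀ i j, d i < d j → d' i < d' j := fun i j hij => by
    refine Nat.lt_of_mul_lt_mul_left (a := m) ?_
    rw [← hd', ← hd']
    exact Nat.mul_lt_mul_of_pos_right hij hn'
  refine ⟨d', ⟨?_, hlt _ _ h20, ?_, hlt _ _ h13, ?_, ?_⟩, (m : ℚ) / n, by positivity, ?_, ?_⟩
  · refine Nat.pos_of_ne_zero fun h0 => ?_
    have := hd' 2
    rw [h0, mul_zero] at this
    exact (Nat.mul_pos h2 hn').ne' this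
  · refine Nat.le_of_mul_le_mul_left (c := m) ?_ hm
    rw [← hd', ← hd']
    exact Nat.mul_le_mul_right _ h01
  · refine Nat.lt_of_mul_lt_mul_left (a := m) ?_
    rw [← hd']
    exact Nat.mul_lt_mul_of_pos_right h3 hn'
  · refine Nat.eq_of_mul_eq_mul_left hm ?_
    rw [mul_add, mul_add, ← hd', ← hd', ← hd', ← hd', ← add_mul, ← add_mul, hsum]
  · field_simp
  · intro i
    have : (d i : ℚ) * n = m * d' i := by exact_mod_cast hd' i
    field_simp
    linarith

theorem two_mul_eq_of_zetaRoot_pow_eq_neg_one {m k : ℕ} (hk : 0 < k) (hkm : k < m)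
    (h : zetaRoot m ^ k = -1) : 2 * k = m := by
  have h1 : zetaRoot m ^ (2 * k) = 1 := by rw [mul_comm, pow_mul, h]; norm_num
  obtain ⟨c, hc⟩ := ((isPrimitiveRoot_zetaRoot (by omega)).pow_eq_one_iff_dvd _).1 h1
  have hc1 : c < 2 := Nat.lt_of_mul_lt_mul_left (a := m) (by omega)
  interval_cases c <;> omega

/-! ### The classification and finiteness -/

theorem theorem4p7 (L : IntermediateField ℚ ℂ) (hfin : FiniteDimensional ℚ L)
    (hreal : ∀ z ∈ L, z.im = 0) :
    (crossValues ∩ (L : Set ℂ)).Finite ∧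
      ∃ mL : ℕ, 4 ≤ mL ∧ ∃ S : Finset (Fin 4 → ℕ),
        (∀ d ∈ S, d ∈ quadruples mL ∧ crossValue mL d ∈ L) ∧
        ∀ m : ℕ, 4 ≤ m → ∀ d ∈ quadruples m, crossValue m d ∈ L →
          IsTypeXII m d (crossValue m d) ∨ IsTypeXIII m d (crossValue m d) ∨
            ∃ d' ∈ S, IsScaling m d mL d' := by
  obtain ⟨n, hn6, hn⟩ := exists_cyclotomicSubfield_of_finiteDimensional L 6
  set N := n.factorial with hN
  have hN0 : N ≠ 0 := Nat.factorial_ne_zero n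
  have hprimes : ∀ p : ℕ, p.Prime → p ≤ 6 → p ∣ N := fun p hp hp6 =>
    Nat.dvd_factorial hp.pos (hp6.trans hn6)
  have hmL : 4 ≤ 2 * N := by
    have := Nat.self_le_factorial n
    omega
  have hSfin : {d | d ∈ quadruples (2 * N) ∧ crossValue (2 * N) d ∈ L}.Finite :=
    (finite_quadruples _).subset fun d hd => hd.1
  have hclass : ∀ m : ℕ, 4 ≤ m → ∀ d ∈ quadruples m, crossValue m d ∈ L →
      IsTypeXII m d (crossValue m d) ∨ IsTypeXIII m d (crossValue m d) ∨
        ∃ d' ∈ hSfin.toFinset, IsScaling m d (2 * N) d' := by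
    intro m hm d hd hdL
    obtain ⟨q, hq1, hq⟩ := exists_one_lt_crossValue_eq hd
    have hm0 : m ≠ 0 := by omega
    have hprim := isPrimitiveRoot_zetaRoot hm0
    have hqN : (q : ℂ) ∈ cyclotomicSubfield N := by
      rw [← hq]
      exact hn m hm0 _ hdL (crossValue_mem_cyclotomicSubfield m d)
    obtain ⟨h2, h20, h01, h13, h3, hsum⟩ := id hd
    have hpow : ∀ k, (zetaRoot m ^ k) ^ (N * m) = 1 := fun k => by
      rw [← pow_mul, ← mul_assoc, mul_comm, pow_mul, hprim.pow_eq_one, one_pow]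
    have hne1 : ∀ k, 0 < k → k < m → zetaRoot m ^ k ≠ 1 := fun k hk hkm =>
      hprim.pow_ne_one_of_pos_of_lt hk.ne' hkm
    have hrel : (1 - zetaRoot m ^ d 0) * (1 - zetaRoot m ^ d 1) =
        q * ((1 - zetaRoot m ^ d 2) * (1 - zetaRoot m ^ d 3)) := by
      rw [← hq, crossValue, div_mul_cancel₀]
      exact mul_ne_zero (sub_ne_zero.2 (hne1 _ h2 (by omega)).symm)
        (sub_ne_zero.2 (hne1 _ (by omega) h3).symm)
    rcases pow_eq_one_or_eq_two hprimes (mul_ne_zero hN0 hm0) (Dvd.intro m rfl) hq1 hqN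
      (hpow (d 0)) (hpow (d 1)) (hpow (d 2)) (hpow (d 3)) (hne1 _ (by omega) (by omega))
      (hne1 _ (by omega) (by omega))
      (fun h => h20.ne' (hprim.pow_inj (by omega) (by omega) h))
      (fun h => (h01.trans_lt h13).ne (hprim.pow_inj (by omega) (by omega) h))
      (by rw [← pow_add, ← pow_add, hsum]) hrel with ⟨h0, h1, h2', h3'⟩ | ⟨hq2, hxy, hzw⟩
    · obtain ⟨d', hd', hsc⟩ := exists_isScaling_of_pow_eq_one hd (n := 2 * N) (by omega)
        (Fin.forall_fin_succ.2 ⟨h0, Fin.forall_fin_succ.2 ⟨h1, Fin.forall_fin_two.2 ⟨h2', h3'⟩⟩⟩)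
      exact Or.inr (Or.inr ⟨d', hSfin.mem_toFinset.2 ⟨hd', hsc.crossValue_eq ▸ hdL⟩, hsc⟩)
    · have hval : crossValue m d = 2 := by rw [hq, hq2]; norm_num
      -- From w = -z follows k₄ - k₃ = m/2; then x = -1 or y = -1 makes k₁ or k₂ equal to m/2.
      have hdiff : zetaRoot m ^ (d 3 - d 2) = -1 := by
        refine mul_left_cancel₀ (pow_ne_zero (d 2) (hprim.ne_zero hm0)) ?_
        rw [← pow_add, Nat.add_sub_cancel' (by omega), hzw, mul_neg_one]
      have hs := two_mul_eq_of_zetaRoot_pow_eq_neg_one (by omega) (by omega) hdiff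
      have hext : ∀ a b c e : ℕ, d 0 = a → d 1 = b → d 2 = c → d 3 = e → d = ![a, b, c, e] := by
        rintro _ _ _ _ rfl rfl rfl rfl
        ext i
        fin_cases i <;> rfl
      rcases hxy with hx | hy
      · have hs0 := two_mul_eq_of_zetaRoot_pow_eq_neg_one (by omega) (by omega) hx
        exact Or.inr (Or.inl ⟨d 0, d 2, by omega, by omega, by omega, by omega,
          hext _ _ _ _ rfl (by omega) rfl (by omega), hval⟩)
      · have hs1 := two_mul_eq_of_zetaRoot_pow_eq_neg_one (by omega) (by omega) hy
        exact Or.inl ⟨d 1, d 2, by omega, by omega, by omega, by omega,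
          hext _ _ _ _ (by omega) rfl rfl (by omega), hval⟩
  refine ⟨?_, 2 * N, hmL, hSfin.toFinset, fun d hd => hSfin.mem_toFinset.1 hd, hclass⟩
  -- Both infinite families contribute only the value 2, and scaling preserves `crossValue`.
  refine ((hSfin.image (crossValue (2 * N))).insert 2).subset ?_
  rintro _ ⟨⟨m, hm, d, hd, rfl⟩, hdL⟩
  rcases hclass m hm d hd hdL with ⟨s, k, -, -, -, -, -, h⟩ | ⟨s, k, -, -, -, -, -, h⟩ |
    ⟨d', hd', hsc⟩
  · exact Or.inl h
  · exact Or.inl h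
  · exact Or.inr ⟨d', hSfin.mem_toFinset.1 hd', hsc.crossValue_eq.symm⟩
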